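/- Let $S=\mathbb{C}[x,y,z,w]$ and let $f\in S$ be a squarefree homogeneous polynomial of degree $d$ whose partial derivatives $f_x,f_y,f_z,f_w$ are linearly independent over $\mathbb{C}$; that is, $D:f=0$ is a reduced surface in $\mathbb{P}^3$ that is not a cone over a plane curve. Let $$AR(f)=\{(\alpha,\beta,\gamma,\delta)\in S^4:\ \alpha f_x+\beta f_y+\gamma f_z+\delta f_w=0\}$$ be the graded $S$-module of Jacobian syzygies, a syzygy having degree $q$ when its four components are homogeneous of degree $q$. For $\rho=(\alpha,\beta,\gamma,\delta)$ put $\omega(\rho)=\alpha\,dx+\beta\,dy+\gamma\,dz+\delta\,dw$, and let $\iota_X$ be the interior product of differential forms with the gradient vector field $X=\nabla f$ of $f$, so that $\iota_X(\omega(\rho))=\alpha f_x+\beta f_y+\gamma f_z+\delta f_w$. Let $\rho_1$ be a nonzero homogeneous element of minimal degree $e_1$ in $AR(f)$, and let $\rho_2\in AR(f)$ be a homogeneous representative of a nonzero homogeneous element of minimal degree $e_2$ in $AR(f)/S\rho_1$ (so $e_1\le e_2$). Assume that $D$ is tame with respect to $\rho_1,\rho_2$, i.e. that for $\rho\in AR(f)$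 one has $\omega(\rho_1)\wedge\omega(\rho_2)\wedge\omega(\rho)=0$ if and only if $\rho\in S\rho_1+S\rho_2$. Set $e_3=d-1-e_1-e_2$ and assume $e_3\ge e_2$. Let $B(f)\subseteq S$ be the ideal of all polynomials $h$ for which there is some $\rho\in AR(f)$ with $$\omega(\rho_1)\wedge\omega(\rho_2)\wedge\omega(\rho)=h\,\iota_X(dx\wedge dy\wedge dz\wedge dw),$$ and let $B(f)_1$ be the complex vector space of linear forms in $B(f)$. Then $D$ is nearly free with exponents $e_1,e_2,e_3+1$ if and only if $\dim_{\mathbb{C}}B(f)_1=2$. Here $D$ is called nearly free with exponents $d_1,d_2,d_3$, where $1\le d_1\le d_2\le d_3$ are integers, if, with $d_4=d_3$, the Milnor algebra $S/(f_x,f_y,f_z,f_w)$ has a minimal graded free resolution of the form $$0\to S(-d-d_3)\to\bigoplus_{j=1}^{4}S(-d-d_j+1)\to S^4(-d+1)\xrightarrow{(f_x,f_y,f_z,f_w)}S.$$ -/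

import Mathlib

noncomputable section

namespace TameSurface

/-- The polynomial ring `S = ℂ[x, y, z, w]`, the variables being indexed by `Fin 4`. -/
abbrev S : Type := MvPolynomial (Fin 4) ℂ

/-- A vector in `S⁴` is homogeneous of degree `k` when all its components are
(the zero vector is homogeneous of every degree). -/
def HomogeneousVec (ρ : Fin 4 → S) (k : ℕ) : Prop :=
  ∀ i, (ρ i).IsHomogeneous k

/-- The `S`-linear map `S⁴ → S`, `(α, β, γ, δ) ↦ α f_x + β f_y + γ f_z + δ f_w`. -/
def jacMap (f : S) : (Fin 4 → S) →ₗ[S] S :=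
  Fintype.linearCombination S (fun i => MvPolynomial.pderiv i f)

/-- The module `AR(f) ⊆ S⁴` of all Jacobian syzygies of `f`. -/
def AR (f : S) : Submodule S (Fin 4 → S) :=
  LinearMap.ker (jacMap f)

/-- The algebra `Ω^*` of algebraic differential forms on `ℂ⁴`, i.e. the exterior algebra over `S`
of the free module with basis `dx, dy, dz, dw`. -/
abbrev Forms : Type := ExteriorAlgebra S (Fin 4 → S)

/-- The 1-form `ω(ρ) = α dx + β dy + γ dz + δ dw` attached to `ρ = (α, β, γ, δ)`. -/
def omega (ρ : Fin 4 → S) : Forms :=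
  ExteriorAlgebra.ι S ρ

/-- The basic 1-form `dx_i`. -/
def dX (i : Fin 4) : Forms :=
  omega (Pi.single i 1)

/-- The volume form `dx ∧ dy ∧ dz ∧ dw`. -/
def vol : Forms :=
  dX 0 * dX 1 * dX 2 * dX 3

/-- The interior product `ι_X` of differential forms with the gradient vector field `X = ∇f`:
the anti-derivation that maps a 1-form `ω(ρ)` to `α f_x + β f_y + γ f_z + δ f_w`. -/
def iotaGrad (f : S) : Forms →ₗ[S] Forms :=
  CliffordAlgebra.contractLeft (Q := (0 : QuadraticForm S (Fin 4 → S))) (jacMap f)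

/-- `ρ₁` is a nonzero homogeneous syzygy of minimal degree `e₁` in `AR(f)`, and `ρ₂` is a
homogeneous representative in `AR(f)` of a nonzero homogeneous element of minimal degree `e₂`
of the quotient `AR(f) / S ρ₁`. -/
structure IsMinimalPair (f : S) (ρ₁ ρ₂ : Fin 4 → S) (e₁ e₂ : ℕ) : Prop where
  mem₁ : ρ₁ ∈ AR f
  hom₁ : HomogeneousVec ρ₁ e₁
  ne_zero₁ : ρ₁ ≠ 0
  min₁ : ∀ ρ ∈ AR f, ∀ k : ℕ, HomogeneousVec ρ k → ρ ≠ 0 → e₁ ≤ k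
  mem₂ : ρ₂ ∈ AR f
  hom₂ : HomogeneousVec ρ₂ e₂
  notMem₂ : ρ₂ ∉ Submodule.span S {ρ₁}
  min₂ : ∀ ρ ∈ AR f, ∀ k : ℕ, HomogeneousVec ρ k → ρ ∉ Submodule.span S {ρ₁} → e₂ ≤ k

/-- Exactness of `S ⊕ S → Ω¹₀ → Ω³`, where `Ω¹₀ = {ω(ρ) : ρ ∈ AR(f)}`, the first map is
`(a, b) ↦ a ω(ρ₁) + b ω(ρ₂)` and the second one is the wedge product with `ω(ρ₁) ∧ ω(ρ₂)`. -/
def IsTame (f : S) (ρ₁ ρ₂ : Fin 4 → S) : Prop :=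
  ∀ ρ ∈ AR f, omega ρ₁ * omega ρ₂ * omega ρ = 0 ↔
    ∃ a b : S, a • omega ρ₁ + b • omega ρ₂ = omega ρ

/-- The image `B(f)` of the morphism `v'` on `AR(f)` which maps `ρ` to the unique polynomial `h`
with `ω(ρ₁) ∧ ω(ρ₂) ∧ ω(ρ) = h ι_X(dx ∧ dy ∧ dz ∧ dw)`. -/
def bourbakiIdeal (f : S) (ρ₁ ρ₂ : Fin 4 → S) : Ideal S where
  carrier := {h | ∃ ρ ∈ AR f, omega ρ₁ * omega ρ₂ * omega ρ = h • iotaGrad f vol}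
  zero_mem' := ⟨0, Submodule.zero_mem _, by simp [omega]⟩
  add_mem' := by
    rintro a b ⟨ρ, hρ, h⟩ ⟨σ, hσ, h'⟩
    refine ⟨ρ + σ, Submodule.add_mem _ hρ hσ, ?_⟩
    rw [add_smul, ← h, ← h']
    simp [omega, mul_add]
  smul_mem' := by
    rintro c a ⟨ρ, hρ, h⟩
    refine ⟨c • ρ, Submodule.smul_mem _ c hρ, ?_⟩
    rw [smul_eq_mul, mul_smul, ← h]
    simp [omega]

/-- The degree `k` homogeneous component of an ideal of `S`, as a complex vector space. -/
def idealComponent (I : Ideal S) (k : ℕ) : Submodule ℂ S :=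
  I.restrictScalars ℂ ⊓ MvPolynomial.homogeneousSubmodule (Fin 4) ℂ k

/-- `D : f = 0` is nearly free with exponents `d₁ ≤ d₂ ≤ d₃ = d₄`: the Milnor algebra
`S / (f_x, f_y, f_z, f_w)` has a minimal graded free resolution
`0 → S(-d-d₃) → ⨁_{j=1}^{4} S(-d-d_j+1) → S⁴(-d+1) → S`, `d = deg f`,
whose last map is given by the partial derivatives of `f`.
Here `r j` is the image of the `j`-th basis vector of the second module, hence homogeneous of
degree `d_j`, and `a` is the image of the generator of the first one, hence with `j`-th component
homogeneous of degree `d₃ + 1 - d_j`. The resolution is minimal when all the entries of the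
matrices of its maps lie in the maximal ideal `(x, y, z, w)`. -/
def IsNearlyFree (f : S) (d₁ d₂ d₃ : ℕ) : Prop :=
  1 ≤ d₁ ∧ d₁ ≤ d₂ ∧ d₂ ≤ d₃ ∧
  ∃ (r : Fin 4 → Fin 4 → S) (a : Fin 4 → S),
    (∀ j, HomogeneousVec (r j) (![d₁, d₂, d₃, d₃] j)) ∧
    (∀ j, (a j).IsHomogeneous (d₃ + 1 - ![d₁, d₂, d₃, d₃] j)) ∧
    Function.Injective (LinearMap.toSpanSingleton S (Fin 4 → S) a) ∧
    Function.Exact (LinearMap.toSpanSingleton S (Fin 4 → S) a) (Fintype.linearCombination S r) ∧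
    Function.Exact (Fintype.linearCombination S r) (jacMap f) ∧
    (∀ j, MvPolynomial.constantCoeff (a j) = 0) ∧
    (∀ j i, MvPolynomial.constantCoeff (r j i) = 0) ∧
    (∀ i, MvPolynomial.constantCoeff (MvPolynomial.pderiv i f) = 0)

end TameSurface

end

/-! Identify a 3-form `ι_u(dx ∧ dy ∧ dz ∧ dw)` with the vector `u`; then `ω(ρ₁) ∧ ω(ρ₂) ∧ ω(ρ)`
becomes the vector of signed maximal minors, which is proportional to `∇f` because all three
syzygies are orthogonal to it. As `f` is squarefree, the partials have no common prime factor, so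
the ratio is a polynomial, called below the value of `ρ`. Tameness then gives an exact sequence `0 →
S(-e₁) ⊕ S(-e₂) → AR(f) → B(f)(-e₃) → 0` (`bourbakiSequence`).

If `B(f)₁` has basis `l₁, l₂`, lift it to syzygies `ρ₃, ρ₄` of degree `e₃ + 1`. The crucial point is
that `B(f) = (l₁, l₂)`: an element outside this prime ideal would force `1 ∈ B(f)`
(`one_mem_of_notMem`), hence `dim B(f)₁ = 4`. So `ρ₁, …, ρ₄` generate `AR(f)`, and the Koszul
relation between `l₁` and `l₂` lifts to the only relation between them.

Conversely, in a nearly free resolution the two generators of low degree have value zero, so the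
values of the other two are linear forms generating `B(f)`; they are independent because the
resolution is minimal. -/

noncomputable section

namespace TameSurface

open MvPolynomial

/-! ### Divisibility and homogeneous components of polynomials. -/

section Polynomials

variable {σ R : Type*} [CommRing R]

theorem homogeneousComponent_mul_of_le {p q : MvPolynomial σ R} {m n : ℕ}
    (hq : q.IsHomogeneous m) (h : m ≤ n) :
    homogeneousComponent n (p * q) = homogeneousComponent (n - m) p * q := by
  let := gradedAlgebra (σ := σ) (R := R)
  have := DirectSum.coe_decompose_mul_of_right_mem_of_le (homogeneousSubmodule σ R)
    (a := p) (b := q) hq h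
  rw [← decomposition.decompose'_apply, ← decomposition.decompose'_apply]
  exact this

theorem homogeneousComponent_mul_of_lt {p q : MvPolynomial σ R} {m n : ℕ}
    (hq : q.IsHomogeneous m) (h : n < m) :
    homogeneousComponent n (p * q) = 0 := by
  let := gradedAlgebra (σ := σ) (R := R)
  have := DirectSum.coe_decompose_mul_of_right_mem_of_not_le (homogeneousSubmodule σ R)
    (a := p) (b := q) hq (not_le.2 h)
  rw [← decomposition.decompose'_apply]
  exact this

theorem homogeneousComponent_mul_add {p q : MvPolynomial σ R} {m : ℕ} (n : ℕ)
    (hq : q.IsHomogeneous m) :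
    homogeneousComponent (n + m) (p * q) = homogeneousComponent n p * q := by
  rw [homogeneousComponent_mul_of_le hq (Nat.le_add_left _ _), Nat.add_sub_cancel]

theorem totalDegree_pderiv_lt {p : MvPolynomial σ R} {i : σ} (h : pderiv i p ≠ 0) :
    (pderiv i p).totalDegree < p.totalDegree := by
  obtain ⟨m, hm, hmax⟩ := Finset.exists_mem_eq_sup (pderiv i p).support
    (support_nonempty.2 h) (fun s => s.sum fun _ e => e)
  have h1 : m + Finsupp.single i 1 ∈ p.support := by
    rw [mem_support_iff] at hm ⊢
    intro h0
    rw [coeff_pderiv, h0, zero_mul] at hm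
    exact hm rfl
  have h2 := le_totalDegree h1
  rw [Finsupp.sum_add_index' (by simp) (by simp), Finsupp.sum_single_index rfl] at h2
  rw [totalDegree, hmax]
  omega

/-- Differentiation lowers the degree, so divisibility forces every partial derivative to vanish; in
characteristic zero `p` is then constant. -/
theorem isUnit_of_forall_dvd_pderiv {K : Type*} [Field K] [CharZero K] {p : MvPolynomial σ K}
    (hp : p ≠ 0) (h : ∀ i, p ∣ pderiv i p) : IsUnit p := by
  have h0 : ∀ i, pderiv i p = 0 := fun i => by
    by_contra hne
    exact absurd (totalDegree_le_of_dvd_of_isDomain (h i) hne)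
      (not_le.2 (totalDegree_pderiv_lt hne))
  have hC : p = C (coeff 0 p) := by
    classical
    ext m
    rw [coeff_C]
    split_ifs with hm
    · rw [hm]
    · obtain ⟨i, hi⟩ : ∃ i, m i ≠ 0 := by
        by_contra! hc
        exact hm (Finsupp.ext fun i => (hc i).symm)
      have h1 := congrArg (coeff (m - Finsupp.single i 1)) (h0 i)
      have h2 : m - Finsupp.single i 1 + Finsupp.single i 1 = m :=
        tsub_add_cancel_of_le (Finsupp.single_le_iff.2 (Nat.one_le_iff_ne_zero.2 hi))
      rw [coeff_pderiv, h2, coeff_zero] at h1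
      exact (mul_eq_zero.1 h1).resolve_right (Nat.cast_add_one_ne_zero _)
  have hc : coeff 0 p ≠ 0 := fun hc => hp (by rw [hC, hc, C_0])
  rw [hC]
  exact (IsUnit.mk0 _ hc).map C

/-- The partial derivatives of a squarefree form of positive degree have no common prime factor. -/
theorem exists_not_dvd_pderiv {K : Type*} [Field K] [CharZero K] [Fintype σ]
    {f : MvPolynomial σ K} {d : ℕ} (hf : f.IsHomogeneous d) (hd : d ≠ 0) (hred : Squarefree f)
    {p : MvPolynomial σ K} (hp : Prime p) : ∃ i, ¬ p ∣ pderiv i f := by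
  by_contra! h
  -- Euler's formula: `d • f` is a combination of the partials, and `d` is invertible.
  have hpf : p ∣ f := by
    have h1 : p ∣ d • f := by
      rw [← hf.sum_X_mul_pderiv]
      exact Finset.dvd_sum fun i _ => (h i).mul_left _
    have h2 : f = C ((d : K)⁻¹) * d • f := by
      rw [nsmul_eq_mul, ← mul_assoc, ← C_eq_coe_nat, ← C_mul,
        inv_mul_cancel₀ (Nat.cast_ne_zero.2 hd), C_1, one_mul]
    rw [h2]
    exact h1.mul_left _
  obtain ⟨g, rfl⟩ := hpf
  have hpg : ¬ p ∣ g := fun ⟨k, hk⟩ =>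
    hp.not_isUnit (hred p ⟨k, by rw [hk, mul_assoc]⟩)
  refine hp.not_isUnit (isUnit_of_forall_dvd_pderiv hp.ne_zero fun i => ?_)
  have h1 := h i
  rw [pderiv_mul] at h1
  exact (hp.dvd_or_dvd ((dvd_add_left (dvd_mul_right p _)).1 h1)).resolve_right hpg

/-- Prime factors of `a` are cancelled one at a time: each misses some `g i`, hence divides `b`. -/
theorem dvd_of_forall_dvd_mul {A ι : Type*} [CommRing A] [IsDomain A]
    [UniqueFactorizationMonoid A] {g : ι → A} (hne : ∃ i, g i ≠ 0)
    (hg : ∀ p, Prime p → ∃ i, ¬ p ∣ g i)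
    (a b : A) (h : ∀ i, a ∣ b * g i) : a ∣ b := by
  induction a using UniqueFactorizationMonoid.induction_on_prime generalizing b with
  | h₁ =>
    obtain ⟨i, hi⟩ := hne
    exact zero_dvd_iff.2 ((mul_eq_zero.1 (zero_dvd_iff.1 (h i))).resolve_right hi)
  | h₂ x hx => exact hx.dvd
  | h₃ a p ha hp ih =>
    obtain ⟨i, hi⟩ := hg p hp
    obtain ⟨c, rfl⟩ := (hp.dvd_or_dvd ((dvd_mul_right p a).trans (h i))).resolve_right hi
    exact mul_dvd_mul_left p (ih c fun j =>
      (mul_dvd_mul_iff_left hp.ne_zero).1 (by simpa [mul_assoc] using h j))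

/-! ### Ideals generated by linear forms. -/

section LinearForms

variable {K : Type*} [Field K] {W : Submodule K (MvPolynomial σ K)}

/-- A `K`-algebra endomorphism of the polynomial ring whose kernel is generated by a given space
of linear forms. -/
theorem exists_algHom_ker_eq_span (hW : W ≤ homogeneousSubmodule σ K 1) :
    ∃ φ : MvPolynomial σ K →ₐ[K] MvPolynomial σ K,
      (∀ p, φ p = 0 ↔ p ∈ Ideal.span (W : Set (MvPolynomial σ K))) ∧
      ∀ l ∈ homogeneousSubmodule σ K 1, l - φ l ∈ W := by
  obtain ⟨g, hg⟩ := LinearMap.exists_leftInverse_of_injective W.subtype W.ker_subtype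
  -- `π` is a linear projection with kernel `W`; substituting `π (X i)` for `X i` kills `W` and
  -- changes nothing modulo `W`.
  let π : MvPolynomial σ K →ₗ[K] MvPolynomial σ K := LinearMap.id - W.subtype ∘ₗ g
  have hπ : ∀ w ∈ W, π w = 0 := fun w hw => by
    have : g w = ⟨w, hw⟩ := LinearMap.congr_fun hg ⟨w, hw⟩
    simp [π, this]
  let φ : MvPolynomial σ K →ₐ[K] MvPolynomial σ K := aeval fun i => π (X i)
  have hlin : ∀ l ∈ homogeneousSubmodule σ K 1, φ l = π l := by
    intro l hl
    rw [homogeneousSubmodule_one_eq_span_X] at hl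
    refine LinearMap.eqOn_span (f := φ.toLinearMap) (g := π) ?_ hl
    rintro _ ⟨i, rfl⟩
    simp [φ]
  have hφW : ∀ w ∈ W, φ w = 0 := fun w hw => by rw [hlin w (hW hw), hπ w hw]
  have hsub : ∀ p, p - φ p ∈ Ideal.span (W : Set (MvPolynomial σ K)) := by
    intro p
    rw [← Ideal.Quotient.mk_eq_mk_iff_sub_mem]
    have : (Ideal.Quotient.mkₐ K (Ideal.span (W : Set (MvPolynomial σ K)))) =
        (Ideal.Quotient.mkₐ K (Ideal.span (W : Set (MvPolynomial σ K)))).comp φ := by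
      refine algHom_ext fun i => ?_
      refine (Ideal.Quotient.mk_eq_mk_iff_sub_mem _ _).2 (Ideal.subset_span ?_)
      simp [φ, π]
    exact DFunLike.congr_fun this p
  refine ⟨φ, fun p => ⟨fun h => by simpa [h] using hsub p, fun h => ?_⟩, fun l hl => ?_⟩
  · have : Ideal.span (W : Set (MvPolynomial σ K)) ≤ RingHom.ker φ :=
      Ideal.span_le.2 fun w hw => hφW w hw
    exact this h
  · rw [hlin l hl]
    simp [π]

theorem isPrime_span_linearForms (hW : W ≤ homogeneousSubmodule σ K 1) :
    (Ideal.span (W : Set (MvPolynomial σ K))).IsPrime := by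
  obtain ⟨φ, hφ, -⟩ := exists_algHom_ker_eq_span hW
  have : Ideal.span (W : Set (MvPolynomial σ K)) = RingHom.ker φ := by
    ext p
    exact (hφ p).symm
  rw [this]
  exact RingHom.ker_isPrime _

theorem mem_of_mem_ideal_span (hW : W ≤ homogeneousSubmodule σ K 1) {l : MvPolynomial σ K}
    (hl : l.IsHomogeneous 1) (h : l ∈ Ideal.span (W : Set (MvPolynomial σ K))) : l ∈ W := by
  obtain ⟨φ, hφ, hφ'⟩ := exists_algHom_ker_eq_span hW
  simpa [(hφ l).2 h] using hφ' l hl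

theorem ideal_span_coe_span (s : Set (MvPolynomial σ K)) :
    Ideal.span (Submodule.span K s : Set (MvPolynomial σ K)) = Ideal.span s :=
  Submodule.span_span_of_tower K _ s

/-- Linearly independent linear forms `l₁, l₂` generate a prime ideal. -/
theorem isPrime_span_pair {l₁ l₂ : MvPolynomial σ K} (h₁ : l₁.IsHomogeneous 1)
    (h₂ : l₂.IsHomogeneous 1) : (Ideal.span {l₁, l₂}).IsPrime := by
  rw [← ideal_span_coe_span]
  exact isPrime_span_linearForms (Submodule.span_le.2 (by
    rintro l (rfl | rfl) <;> assumption))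

/-- The ideal `(l₁)` is prime, and its only linear forms are the scalar multiples of `l₁`, so it
does not contain `l₂`. -/
theorem dvd_of_dvd_mul_of_linearIndependent {l₁ l₂ : MvPolynomial σ K} (h₁ : l₁.IsHomogeneous 1)
    (h₂ : l₂.IsHomogeneous 1) (hli : LinearIndependent K ![l₁, l₂]) {p : MvPolynomial σ K}
    (h : l₁ ∣ l₂ * p) : l₁ ∣ p := by
  have hW : Submodule.span K {l₁} ≤ homogeneousSubmodule σ K 1 := Submodule.span_le.2 (by
    rintro l rfl; assumption)
  have hp := isPrime_span_linearForms hW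
  rw [ideal_span_coe_span] at hp
  rw [← Ideal.mem_span_singleton] at h ⊢
  refine (hp.mem_or_mem h).resolve_left fun hmem => ?_
  rw [← ideal_span_coe_span] at hmem
  obtain ⟨c, hc⟩ := Submodule.mem_span_singleton.1 (mem_of_mem_ideal_span hW h₂ hmem)
  have := LinearIndependent.pair_iff.1 hli c (-1) (by rw [hc]; simp)
  simp at this

end LinearForms

end Polynomials

/-! ### Three-forms as vectors. -/

section Forms

/-- The cross product of three vectors of `S⁴`: its components are the signed maximal minors. -/
def cross (u v w : Fin 4 → S) : Fin 4 → S :=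
  let m (i j k : Fin 4) : S :=
    u i * (v j * w k - v k * w j) - u j * (v i * w k - v k * w i) + u k * (v i * w j - v j * w i)
  ![m 1 2 3, -m 0 2 3, m 0 1 3, -m 0 1 2]

/-- The `3`-form `ι_u(dx ∧ dy ∧ dz ∧ dw)` attached to a vector field `u`. -/
def star (u : Fin 4 → S) : Forms :=
  u 0 • (dX 1 * dX 2 * dX 3) - u 1 • (dX 0 * dX 2 * dX 3) +
    u 2 • (dX 0 * dX 1 * dX 3) - u 3 • (dX 0 * dX 1 * dX 2)

theorem omega_eq (u : Fin 4 → S) :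
    omega u = u 0 • dX 0 + u 1 • dX 1 + u 2 • dX 2 + u 3 • dX 3 := by
  have h : u = u 0 • Pi.single 0 1 + u 1 • Pi.single 1 1 + u 2 • Pi.single 2 1 +
      u 3 • Pi.single 3 1 := by
    ext i : 1
    fin_cases i <;> simp
  conv_lhs => rw [h]
  simp only [omega, dX, map_add, map_smul]

theorem dX_mul_self (i : Fin 4) : dX i * dX i = 0 := ExteriorAlgebra.ι_sq_zero _

theorem dX_mul_dX (i j : Fin 4) : dX i * dX j = -(dX j * dX i) :=
  eq_neg_of_add_eq_zero_left (ExteriorAlgebra.ι_add_mul_swap _ _)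

theorem omega_mul_omega_mul_omega (u v w : Fin 4 → S) :
    omega u * omega v * omega w = star (cross u v w) := by
  have h2 : omega u * omega v =
      (u 0 * v 1 - u 1 * v 0) • (dX 0 * dX 1) + (u 0 * v 2 - u 2 * v 0) • (dX 0 * dX 2) +
      (u 0 * v 3 - u 3 * v 0) • (dX 0 * dX 3) + (u 1 * v 2 - u 2 * v 1) • (dX 1 * dX 2) +
      (u 1 * v 3 - u 3 * v 1) • (dX 1 * dX 3) + (u 2 * v 3 - u 3 * v 2) • (dX 2 * dX 3) := by
    rw [omega_eq u, omega_eq v]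
    simp only [add_mul, mul_add, smul_mul_assoc, mul_smul_comm, dX_mul_self, dX_mul_dX 1 0,
      dX_mul_dX 2 0, dX_mul_dX 3 0, dX_mul_dX 2 1, dX_mul_dX 3 1, dX_mul_dX 3 2]
    module
  have hs (a : Forms) (i : Fin 4) : a * dX i * dX i = 0 := by
    rw [mul_assoc, dX_mul_self, mul_zero]
  have ht (a : Forms) (i j : Fin 4) : a * dX i * dX j = -(a * dX j * dX i) := by
    rw [mul_assoc, dX_mul_dX, mul_neg, mul_assoc]
  have h3 (i j : Fin 4) : dX i * dX j * dX i = 0 := by rw [ht, dX_mul_self, zero_mul, neg_zero]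
  rw [h2, omega_eq w]
  simp only [add_mul, mul_add, smul_mul_assoc, mul_smul_comm, h3, hs,
      ht _ 2 0, ht _ 3 0, ht _ 2 1, ht _ 3 1, ht _ 3 2, dX_mul_dX 1 0, dX_mul_dX 2 0,
      dX_mul_dX 2 1, neg_mul, star, cross, Matrix.cons_val]
  module

theorem iotaGrad_vol (f : S) : iotaGrad f vol = star (fun i => pderiv i f) := by
  have hj (i : Fin 4) : jacMap f (Pi.single i 1) = pderiv i f := by
    simp [jacMap, Fintype.linearCombination_apply, Pi.single_apply]
  simp only [vol, iotaGrad, dX, omega, mul_assoc, ExteriorAlgebra.ι]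
  simp only [CliffordAlgebra.contractLeft_ι_mul, CliffordAlgebra.contractLeft_ι, hj, star, dX,
    omega, ExteriorAlgebra.ι, mul_sub, mul_smul_comm, Algebra.algebraMap_eq_smul_one, mul_one,
    mul_assoc]
  module

/-- The determinant, extended by zero to the other degrees, is a linear functional on forms taking
the value `1` on `vol`. -/
theorem smul_vol_eq_zero {c : S} (h : c • vol = 0) : c = 0 := by
  let F : ∀ i, (Fin 4 → S) [⋀^Fin i]→ₗ[S] S :=
    Function.update (fun _ => 0) 4 Matrix.detRowAlternating
  have hv : vol = ExteriorAlgebra.ιMulti S 4 (fun i : Fin 4 => (Pi.single i 1 : Fin 4 → S)) := by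
    simp [ExteriorAlgebra.ιMulti_apply, vol, dX, omega, mul_assoc]
    rfl
  have h1 := congrArg (ExteriorAlgebra.liftAlternating F) h
  rw [map_smul, hv, ExteriorAlgebra.liftAlternating_apply_ιMulti, map_zero] at h1
  have h2 : F 4 (fun i : Fin 4 => (Pi.single i 1 : Fin 4 → S)) = 1 := by
    have : (fun i : Fin 4 => (Pi.single i 1 : Fin 4 → S)) = (1 : Matrix (Fin 4) (Fin 4) S) := by
      ext1 i
      ext1 j
      rw [Matrix.one_apply, Pi.single_apply]
      simp only [eq_comm]
    simp only [F, Function.update_self]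
    rw [this]
    exact Matrix.det_one
  rwa [h2, smul_eq_mul, mul_one] at h1

theorem star_injective : Function.Injective star := by
  have hs (a : Forms) (i : Fin 4) : a * dX i * dX i = 0 := by
    rw [mul_assoc, dX_mul_self, mul_zero]
  have ht (a : Forms) (i j : Fin 4) : a * dX i * dX j = -(a * dX j * dX i) := by
    rw [mul_assoc, dX_mul_dX, mul_neg, mul_assoc]
  -- Wedging with `dX i` recovers the `i`-th coordinate.
  have key (u : Fin 4 → S) (i : Fin 4) : dX i * star u = u i • vol := by
    fin_cases i <;>
    simp [star, vol, mul_add, mul_sub, ← mul_assoc, hs, ht _ 2 1, ht _ 3 1, ht _ 3 2, dX_mul_dX 1 0, dX_mul_dX 2 0,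
      dX_mul_dX 2 1, dX_mul_dX 3 0, dX_mul_dX 3 1, dX_mul_self]
  intro u v huv
  ext1 i
  have := congrArg (dX i * ·) huv
  simp only [key] at this
  exact sub_eq_zero.1 (smul_vol_eq_zero (by rw [sub_smul, this, sub_self]))

theorem smul_star (c : S) (u : Fin 4 → S) : c • star u = star (c • u) := by
  simp only [star, Pi.smul_apply, smul_eq_mul]
  module

end Forms

/-! ### Algebra of the cross product. -/

section CrossProduct

variable (u v w w' : Fin 4 → S) (c : S)

theorem cross_add : cross u v (w + w') = cross u v w + cross u v w' := by
  ext1 i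
  fin_cases i <;> simp [cross] <;> ring

theorem cross_sub : cross u v (w - w') = cross u v w - cross u v w' := by
  ext1 i
  fin_cases i <;> simp [cross] <;> ring

theorem cross_smul : cross u v (c • w) = c • cross u v w := by
  ext1 i
  fin_cases i <;> simp [cross] <;> ring

theorem cross_left_self : cross u v u = 0 := by
  ext1 i
  fin_cases i <;> simp [cross] <;> ring

theorem cross_right_self : cross u v v = 0 := by
  ext1 i
  fin_cases i <;> simp [cross] <;> ring

variable {u v w}

theorem cross_eq_zero_of_minors (h : ∀ i j, u i * v j - u j * v i = 0) : cross u v w = 0 := by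
  ext1 i
  fin_cases i <;> simp only [cross, Pi.zero_apply, Fin.zero_eta, Fin.mk_one, Fin.reduceFinMk,
    Matrix.cons_val]
  · linear_combination w 1 * h 2 3 - w 2 * h 1 3 + w 3 * h 1 2
  · linear_combination -w 0 * h 2 3 + w 2 * h 0 3 - w 3 * h 0 2
  · linear_combination w 0 * h 1 3 - w 1 * h 0 3 + w 3 * h 0 1
  · linear_combination -w 0 * h 1 2 + w 1 * h 0 2 - w 2 * h 0 1

/-- If `g` is orthogonal to `u, v, w`, then it is proportional to their cross product. -/
theorem cross_mul_comm {g : Fin 4 → S} (hu : ∑ i, u i * g i = 0) (hv : ∑ i, v i * g i = 0)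
    (hw : ∑ i, w i * g i = 0) (i j : Fin 4) : cross u v w i * g j = cross u v w j * g i := by
  rw [Fin.sum_univ_four] at hu hv hw
  -- Laplace expansion: this combination of the three orthogonality relations removes the terms in
  -- `g k` and `g l`, leaving two maximal minors times the other two coordinates of `g`.
  have key (k l : Fin 4) := congrArg₂ (· + ·) (congrArg₂ (· - ·)
    (congrArg ((v k * w l - v l * w k) * ·) hu) (congrArg ((u k * w l - u l * w k) * ·) hv))
    (congrArg ((u k * v l - u l * v k) * ·) hw)
  have h01 : cross u v w 0 * g 1 = cross u v w 1 * g 0 := by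
    simp only [cross, Matrix.cons_val]; linear_combination key 2 3
  have h02 : cross u v w 0 * g 2 = cross u v w 2 * g 0 := by
    simp only [cross, Matrix.cons_val]; linear_combination -key 1 3
  have h03 : cross u v w 0 * g 3 = cross u v w 3 * g 0 := by
    simp only [cross, Matrix.cons_val]; linear_combination key 1 2
  have h12 : cross u v w 1 * g 2 = cross u v w 2 * g 1 := by
    simp only [cross, Matrix.cons_val]; linear_combination key 0 3
  have h13 : cross u v w 1 * g 3 = cross u v w 3 * g 1 := by
    simp only [cross, Matrix.cons_val]; linear_combination -key 0 2
  have h23 : cross u v w 2 * g 3 = cross u v w 3 * g 2 := by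
    simp only [cross, Matrix.cons_val]; linear_combination key 0 1
  fin_cases i <;> fin_cases j <;>
    simp only [Fin.zero_eta, Fin.mk_one, Fin.reduceFinMk, h01, h02, h03, h12, h13, h23]

theorem exists_cross_eq_smul {g : Fin 4 → S} (hne : ∃ i, g i ≠ 0)
    (hg : ∀ p, Prime p → ∃ i, ¬ p ∣ g i) (hu : ∑ i, u i * g i = 0) (hv : ∑ i, v i * g i = 0)
    (hw : ∑ i, w i * g i = 0) : ∃ h : S, cross u v w = h • g := by
  obtain ⟨i, hi⟩ := hne
  have hcomm := cross_mul_comm hu hv hw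
  obtain ⟨h, hh⟩ := dvd_of_forall_dvd_mul ⟨i, hi⟩ hg (g i) (cross u v w i) fun j =>
    ⟨cross u v w j, by rw [hcomm, mul_comm]⟩
  refine ⟨h, funext fun j => mul_right_cancel₀ hi ?_⟩
  rw [← hcomm, hh, Pi.smul_apply, smul_eq_mul]
  ring

end CrossProduct

/-! ### Homogeneous components of vectors. -/

section HomogeneousComponents

/-- The homogeneous component of degree `k` of a vector of polynomials. -/
def vecComponent (k : ℕ) (u : Fin 4 → S) : Fin 4 → S := fun i => homogeneousComponent k (u i)

theorem homogeneousVec_vecComponent (k : ℕ) (u : Fin 4 → S) :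
    HomogeneousVec (vecComponent k u) k := fun i => homogeneousComponent_isHomogeneous k (u i)

theorem vecComponent_add (k : ℕ) (u v : Fin 4 → S) :
    vecComponent k (u + v) = vecComponent k u + vecComponent k v :=
  funext fun _ => map_add _ _ _

theorem HomogeneousVec.vecComponent_eq {k : ℕ} {u : Fin 4 → S} (h : HomogeneousVec u k) :
    vecComponent k u = u :=
  funext fun i => homogeneousComponent_eq_self (h i)

theorem HomogeneousVec.vecComponent_smul {k n : ℕ} {u : Fin 4 → S} (h : HomogeneousVec u k)
    (hk : k ≤ n) (c : S) : vecComponent n (c • u) = homogeneousComponent (n - k) c • u :=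
  funext fun i => homogeneousComponent_mul_of_le (h i) hk

theorem HomogeneousVec.vecComponent_smul_of_lt {k n : ℕ} {u : Fin 4 → S}
    (h : HomogeneousVec u k) (hk : n < k) (c : S) : vecComponent n (c • u) = 0 :=
  funext fun i => homogeneousComponent_mul_of_lt (h i) hk

theorem HomogeneousVec.smul {k n : ℕ} {u : Fin 4 → S} (h : HomogeneousVec u k) {c : S}
    (hc : c.IsHomogeneous n) : HomogeneousVec (c • u) (n + k) := fun i => hc.mul (h i)

theorem HomogeneousVec.sub {k : ℕ} {u v : Fin 4 → S} (hu : HomogeneousVec u k)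
    (hv : HomogeneousVec v k) : HomogeneousVec (u - v) k :=
  fun i => (hu i).sub (hv i)

theorem cross_vecComponent {u v : Fin 4 → S} {a b : ℕ} (hu : HomogeneousVec u a)
    (hv : HomogeneousVec v b) (w : Fin 4 → S) (k : ℕ) :
    cross u v (vecComponent k w) = vecComponent (k + (a + b)) (cross u v w) := by
  have hm (i j : Fin 4) : (u i * v j - u j * v i).IsHomogeneous (a + b) :=
    ((hu i).mul (hv j)).sub ((hu j).mul (hv i))
  have key (i j l : Fin 4) :
      homogeneousComponent (k + (a + b)) (u i * (v j * w l - v l * w j) -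
        u j * (v i * w l - v l * w i) + u l * (v i * w j - v j * w i)) =
      u i * (v j * vecComponent k w l - v l * vecComponent k w j) -
        u j * (v i * vecComponent k w l - v l * vecComponent k w i) +
        u l * (v i * vecComponent k w j - v j * vecComponent k w i) := by
    -- Expanding along `x` makes the coefficients the 2×2 minors of `u, v`, which are homogeneous of
    -- degree `a + b`.
    have h1 (x : Fin 4 → S) : u i * (v j * x l - v l * x j) -
        u j * (v i * x l - v l * x i) + u l * (v i * x j - v j * x i) =
        x i * (u j * v l - u l * v j) - x j * (u i * v l - u l * v i) +
          x l * (u i * v j - u j * v i) := by ring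
    rw [h1, h1, map_add, map_sub, homogeneousComponent_mul_add k (hm _ _),
      homogeneousComponent_mul_add k (hm _ _), homogeneousComponent_mul_add k (hm _ _)]
    rfl
  ext1 i
  fin_cases i
  · exact (key 1 2 3).symm
  · exact ((map_neg _ _).trans (congrArg Neg.neg (key 0 2 3))).symm
  · exact (key 0 1 3).symm
  · exact ((map_neg _ _).trans (congrArg Neg.neg (key 0 1 2))).symm

end HomogeneousComponents

/-! ### Jacobian syzygies and the Bourbaki sequence. -/

section Syzygies

/-- The gradient of `f`. -/
def grad (f : S) : Fin 4 → S := fun i => pderiv i f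

theorem mem_AR {f : S} {ρ : Fin 4 → S} : ρ ∈ AR f ↔ ∑ i, ρ i * grad f i = 0 := LinearMap.mem_ker

theorem mem_AR_of_smul_mem {f c : S} {ρ : Fin 4 → S} (hc : c ≠ 0) (h : c • ρ ∈ AR f) :
    ρ ∈ AR f := by
  rw [AR, LinearMap.mem_ker, map_smul, smul_eq_mul] at h
  exact (mul_eq_zero.1 h).resolve_left hc

theorem vecComponent_mem_AR {f : S} {m : ℕ} (hg : HomogeneousVec (grad f) m) {ρ : Fin 4 → S}
    (h : ρ ∈ AR f) (k : ℕ) : vecComponent k ρ ∈ AR f := by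
  rw [mem_AR] at h ⊢
  have := congrArg (homogeneousComponent (k + m)) h
  simp only [map_sum, map_zero, homogeneousComponent_mul_add k (hg _)] at this
  exact this

theorem omega_mul_eq_zero_iff {u v w : Fin 4 → S} :
    omega u * omega v * omega w = 0 ↔ cross u v w = 0 := by
  have h0 : star 0 = 0 := by simp [star]
  rw [omega_mul_omega_mul_omega, ← h0, star_injective.eq_iff]

theorem mem_bourbakiIdeal {f : S} {ρ₁ ρ₂ : Fin 4 → S} {h : S} :
    h ∈ bourbakiIdeal f ρ₁ ρ₂ ↔ ∃ ρ ∈ AR f, cross ρ₁ ρ₂ ρ = h • grad f := by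
  change (∃ ρ ∈ AR f, omega ρ₁ * omega ρ₂ * omega ρ = h • iotaGrad f vol) ↔ _
  simp only [iotaGrad_vol, smul_star, omega_mul_omega_mul_omega, star_injective.eq_iff]
  rfl

theorem mem_idealComponent {I : Ideal S} {k : ℕ} {h : S} :
    h ∈ idealComponent I k ↔ h ∈ I ∧ h.IsHomogeneous k := Iff.rfl

/-- The exact sequence `0 → S(-e₁) ⊕ S(-e₂) → AR(f) → B(f)(-e₃) → 0` attached to two homogeneous
syzygies. -/
structure BourbakiSequence (f : S) (ρ₁ ρ₂ : Fin 4 → S) (e₁ e₂ e₃ : ℕ) : Prop where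
  mem₁ : ρ₁ ∈ AR f
  mem₂ : ρ₂ ∈ AR f
  hom₁ : HomogeneousVec ρ₁ e₁
  hom₂ : HomogeneousVec ρ₂ e₂
  hom_grad : HomogeneousVec (grad f) (e₁ + e₂ + e₃)
  grad_ne_zero : grad f ≠ 0
  exists_value : ∀ ρ ∈ AR f, ∃ h : S, cross ρ₁ ρ₂ ρ = h • grad f
  exact : ∀ ρ ∈ AR f, cross ρ₁ ρ₂ ρ = 0 → ∃ a b : S, a • ρ₁ + b • ρ₂ = ρ
  injective : ∀ a b : S, a • ρ₁ + b • ρ₂ = 0 → a = 0 ∧ b = 0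

theorem minors_eq_zero_of_smul_add_smul {u v : Fin 4 → S} {a b : S} (h : a • u + b • v = 0)
    (hab : a ≠ 0 ∨ b ≠ 0) (i j : Fin 4) : u i * v j - u j * v i = 0 := by
  have hi (i : Fin 4) : a * u i + b * v i = 0 := congrFun h i
  rcases hab with ha | hb
  · refine (mul_eq_zero.1 (?_ : a * _ = 0)).resolve_left ha
    linear_combination v j * hi i - v i * hi j
  · refine (mul_eq_zero.1 (?_ : b * _ = 0)).resolve_left hb
    linear_combination u i * hi j - u j * hi i

theorem bourbakiSequence {f : S} {d : ℕ} (hf : f.IsHomogeneous d) (hred : Squarefree f)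
    (hcone : LinearIndependent ℂ (fun i : Fin 4 => pderiv i f)) {ρ₁ ρ₂ : Fin 4 → S}
    {e₁ e₂ e₃ : ℕ} (hmin : IsMinimalPair f ρ₁ ρ₂ e₁ e₂) (htame : IsTame f ρ₁ ρ₂)
    (hd : d = e₁ + e₂ + e₃ + 1) : BourbakiSequence f ρ₁ ρ₂ e₁ e₂ e₃ := by
  have hg (i : Fin 4) : grad f i ≠ 0 := hcone.ne_zero i
  have hex : ∀ ρ ∈ AR f, cross ρ₁ ρ₂ ρ = 0 → ∃ a b : S, a • ρ₁ + b • ρ₂ = ρ := by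
    intro ρ hρ h
    obtain ⟨a, b, hab⟩ := (htame ρ hρ).1 (omega_mul_eq_zero_iff.2 h)
    refine ⟨a, b, (ExteriorAlgebra.ι_inj S _ _).1 ?_⟩
    rw [map_add, map_smul, map_smul]
    exact hab
  refine
    { mem₁ := hmin.mem₁
      mem₂ := hmin.mem₂
      hom₁ := hmin.hom₁
      hom₂ := hmin.hom₂
      hom_grad := fun i => ?_
      grad_ne_zero := fun h => hg 0 (congrFun h 0)
      exists_value := fun ρ hρ => exists_cross_eq_smul ⟨0, hg 0⟩
        (fun p hp => exists_not_dvd_pderiv hf (by omega) hred hp)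
        (mem_AR.1 hmin.mem₁) (mem_AR.1 hmin.mem₂) (mem_AR.1 hρ)
      exact := hex
      injective := fun a b h => ?_ }
  · have := hf.pderiv (i := i)
    rwa [hd, Nat.add_sub_cancel] at this
  · by_contra hab
    rw [not_and_or] at hab
    have hM := minors_eq_zero_of_smul_add_smul h hab
    have hgen (ρ : Fin 4 → S) (hρ : ρ ∈ AR f) := hex ρ hρ (cross_eq_zero_of_minors hM)
    -- A dependence between `ρ₁` and `ρ₂` would make every cross product vanish, so by tameness
    -- `AR(f)` would have rank at most one. Two Koszul syzygies contradict this: their minor in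
    -- columns 1, 2 is `f_x²`.
    obtain ⟨p, q, h1⟩ := hgen ![grad f 1, -grad f 0, 0, 0]
      (by rw [mem_AR, Fin.sum_univ_four]; simp; ring)
    obtain ⟨s, t, h2⟩ := hgen ![grad f 2, 0, -grad f 0, 0]
      (by rw [mem_AR, Fin.sum_univ_four]; simp; ring)
    have h11 := congrFun h1 1
    have h12 := congrFun h1 2
    have h21 := congrFun h2 1
    have h22 := congrFun h2 2
    simp only [Pi.add_apply, Pi.smul_apply, smul_eq_mul, Matrix.cons_val] at h11 h12 h21 h22
    refine mul_ne_zero (hg 0) (hg 0) ?_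
    linear_combination grad f 0 * h22 - h11 * (s * ρ₁ 2 + t * ρ₂ 2) +
      (p * ρ₁ 2 + q * ρ₂ 2) * h21 + (p * t - q * s) * hM 1 2

namespace BourbakiSequence

variable {f : S} {ρ₁ ρ₂ : Fin 4 → S} {e₁ e₂ e₃ : ℕ} (H : BourbakiSequence f ρ₁ ρ₂ e₁ e₂ e₃)
include H

theorem value_unique {h h' : S} (e : h • grad f = h' • grad f) : h = h' := by
  rw [← sub_eq_zero, ← sub_smul] at e
  exact sub_eq_zero.1 ((smul_eq_zero.1 e).resolve_right H.grad_ne_zero)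

theorem cross_vecComponent_eq {ρ : Fin 4 → S} {h : S} (e : cross ρ₁ ρ₂ ρ = h • grad f) (n : ℕ) :
    cross ρ₁ ρ₂ (vecComponent (n + e₃) ρ) = homogeneousComponent n h • grad f := by
  rw [cross_vecComponent H.hom₁ H.hom₂, e, H.hom_grad.vecComponent_smul (by omega),
    show n + e₃ + (e₁ + e₂) - (e₁ + e₂ + e₃) = n by omega]

theorem isHomogeneous_value {ρ : Fin 4 → S} {h : S} {n : ℕ} (hρ : HomogeneousVec ρ (n + e₃))
    (e : cross ρ₁ ρ₂ ρ = h • grad f) : h.IsHomogeneous n := by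
  have h1 := H.cross_vecComponent_eq e n
  rw [hρ.vecComponent_eq, e] at h1
  rw [H.value_unique h1]
  exact homogeneousComponent_isHomogeneous n h

theorem exists_homogeneous_lift {n : ℕ} {h : S} (hB : h ∈ bourbakiIdeal f ρ₁ ρ₂)
    (hh : h.IsHomogeneous n) :
    ∃ ρ ∈ AR f, HomogeneousVec ρ (n + e₃) ∧ cross ρ₁ ρ₂ ρ = h • grad f := by
  obtain ⟨ρ, hρ, e⟩ := mem_bourbakiIdeal.1 hB
  refine ⟨_, vecComponent_mem_AR H.hom_grad hρ (n + e₃), homogeneousVec_vecComponent _ _, ?_⟩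
  rw [H.cross_vecComponent_eq e, homogeneousComponent_eq_self hh]

/-- Two syzygies with values the independent linear forms `l₁, l₂` and a third one with value
outside the ideal `(l₁, l₂)` force `B(f)` to be the whole ring. -/
theorem one_mem_of_notMem {l₁ l₂ h : S} {ρ₃ ρ₄ ρ₅ : Fin 4 → S} (hl₁ : l₁.IsHomogeneous 1)
    (hl₂ : l₂.IsHomogeneous 1) (hli : LinearIndependent ℂ ![l₁, l₂])
    (h₃ : ρ₃ ∈ AR f) (h₄ : ρ₄ ∈ AR f) (h₅ : ρ₅ ∈ AR f) (v₃ : cross ρ₁ ρ₂ ρ₃ = l₁ • grad f)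
    (v₄ : cross ρ₁ ρ₂ ρ₄ = l₂ • grad f) (v₅ : cross ρ₁ ρ₂ ρ₅ = h • grad f)
    (hh : h ∉ Ideal.span {l₁, l₂}) : (1 : S) ∈ bourbakiIdeal f ρ₁ ρ₂ := by
  have hprime := isPrime_span_pair hl₁ hl₂
  have hl₁0 : l₁ ≠ 0 := hli.ne_zero 0
  have rel {p q : S} {σ τ : Fin 4 → S} (hσ : σ ∈ AR f) (hτ : τ ∈ AR f)
      (vσ : cross ρ₁ ρ₂ σ = p • grad f) (vτ : cross ρ₁ ρ₂ τ = q • grad f) :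
      ∃ a b : S, a • ρ₁ + b • ρ₂ = q • σ - p • τ :=
    H.exact _ (sub_mem (Submodule.smul_mem _ _ hσ) (Submodule.smul_mem _ _ hτ)) (by
      rw [cross_sub, cross_smul, cross_smul, vσ, vτ, smul_smul, smul_smul, mul_comm, sub_self])
  obtain ⟨a, b, r1⟩ := rel h₄ h₃ v₄ v₃
  obtain ⟨a', b', r2⟩ := rel h₃ h₅ v₃ v₅
  obtain ⟨a'', b'', r3⟩ := rel h₄ h₅ v₄ v₅
  -- The three relations `r1`, `r2`, `r3` satisfy the Koszul identity on `l₁, l₂, h`, and freeness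
  -- of `ρ₁, ρ₂` lets one compare coefficients.
  obtain ⟨ra, rb⟩ := H.injective (h * a + l₂ * a' - l₁ * a'') (h * b + l₂ * b' - l₁ * b'') (by
    have : h • (a • ρ₁ + b • ρ₂) + l₂ • (a' • ρ₁ + b' • ρ₂) - l₁ • (a'' • ρ₁ + b'' • ρ₂) = 0 := by
      rw [r1, r2, r3]
      module
    rw [← this]
    module)
  have hmem {a a' a'' : S} (ra : h * a + l₂ * a' - l₁ * a'' = 0) :
      ∃ u v : S, u * l₁ + v * l₂ = a := by
    refine Ideal.mem_span_pair.1 ((hprime.mem_or_mem ?_).resolve_left hh)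
    exact Ideal.mem_span_pair.2 ⟨a'', -a', by linear_combination -ra⟩
  obtain ⟨u, v, rfl⟩ := hmem ra
  obtain ⟨u', v', rfl⟩ := hmem rb
  -- With `a` and `b` in `(l₁, l₂)`, relation `r1` reads `l₁ (ρ₄ - u ρ₁ - u' ρ₂) = l₂ (ρ₃ + v ρ₁ +
  -- v' ρ₂)`. Dividing the last bracket by `l₁` yields a syzygy of value `1`.
  have hdvd (i : Fin 4) : l₁ ∣ (ρ₃ + v • ρ₁ + v' • ρ₂) i := by
    refine dvd_of_dvd_mul_of_linearIndependent hl₁ hl₂ hli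
      ⟨(ρ₄ - u • ρ₁ - u' • ρ₂) i, ?_⟩
    have := congrFun r1 i
    simp only [Pi.add_apply, Pi.sub_apply, Pi.smul_apply, smul_eq_mul] at this ⊢
    linear_combination this
  choose τ hτ using hdvd
  replace hτ : ρ₃ + v • ρ₁ + v' • ρ₂ = l₁ • τ := funext hτ
  refine mem_bourbakiIdeal.2 ⟨τ, mem_AR_of_smul_mem hl₁0 ?_, ?_⟩
  · rw [← hτ]
    exact add_mem (add_mem h₃ (Submodule.smul_mem _ _ H.mem₁)) (Submodule.smul_mem _ _ H.mem₂)
  · have := cross_smul ρ₁ ρ₂ τ l₁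
    rw [← hτ, cross_add, cross_add, cross_smul, cross_smul, cross_left_self, cross_right_self,
      smul_zero, smul_zero, add_zero, add_zero, v₃] at this
    rw [one_smul]
    exact (smul_right_injective _ hl₁0 this).symm

end BourbakiSequence

/-! ### The two implications. -/

theorem finrank_eq_two_iff {K V : Type*} [Field K] [AddCommGroup V] [Module K V]
    {W : Submodule K V} : Module.finrank K W = 2 ↔
      ∃ v₁ v₂ : V, LinearIndependent K ![v₁, v₂] ∧ W = Submodule.span K {v₁, v₂} := by
  constructor
  · intro h
    have : Module.Finite K W := Module.finite_of_finrank_pos (by omega)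
    let b := Module.finBasisOfFinrankEq K W h
    have hb : ![(b 0 : V), (b 1 : V)] = W.subtype ∘ b := by
      ext1 i
      fin_cases i <;> rfl
    have hr : ({(b 0 : V), (b 1 : V)} : Set V) = W.subtype '' Set.range b := by
      rw [← Set.range_comp, ← hb, Matrix.range_cons_cons_empty]
    refine ⟨b 0, b 1, ?_, ?_⟩
    · rw [hb]
      exact b.linearIndependent.map' _ W.ker_subtype
    · rw [hr, Submodule.span_image, b.span_eq, Submodule.map_top, Submodule.range_subtype]
  · rintro ⟨v₁, v₂, hli, rfl⟩
    have := finrank_span_eq_card hli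
    rwa [Matrix.range_cons_cons_empty, Fintype.card_fin] at this

namespace BourbakiSequence

variable {f : S} {ρ₁ ρ₂ : Fin 4 → S} {e₁ e₂ e₃ : ℕ} (H : BourbakiSequence f ρ₁ ρ₂ e₁ e₂ e₃)
include H

theorem isNearlyFree_of_finrank_eq_two (h₁ : 1 ≤ e₁) (h₁₂ : e₁ ≤ e₂) (h₂₃ : e₂ ≤ e₃)
    (hB : Module.finrank ℂ (idealComponent (bourbakiIdeal f ρ₁ ρ₂) 1) = 2) :
    IsNearlyFree f e₁ e₂ (e₃ + 1) := by
  -- Otherwise the four variables would be independent elements of `B(f)₁`.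
  have hone : (1 : S) ∉ bourbakiIdeal f ρ₁ ρ₂ := by
    intro h1
    have hfin : Module.Finite ℂ (idealComponent (bourbakiIdeal f ρ₁ ρ₂) 1) :=
      Module.finite_of_finrank_pos (by omega)
    let x : Fin 4 → idealComponent (bourbakiIdeal f ρ₁ ρ₂) 1 := fun i =>
      ⟨X i, by rw [(Ideal.eq_top_iff_one _).2 h1]; exact ⟨trivial, isHomogeneous_X _ _⟩⟩
    have hx : LinearIndependent ℂ x :=
      LinearIndependent.of_comp (Submodule.subtype _) (linearIndependent_X (Fin 4) ℂ)
    have := hx.fintype_card_le_finrank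
    rw [hB, Fintype.card_fin] at this
    omega
  obtain ⟨l₁, l₂, hli, hspan⟩ := finrank_eq_two_iff.1 hB
  obtain ⟨hl₁B, hl₁⟩ := mem_idealComponent.1
    (hspan ▸ Submodule.subset_span (by simp) : l₁ ∈ idealComponent (bourbakiIdeal f ρ₁ ρ₂) 1)
  obtain ⟨hl₂B, hl₂⟩ := mem_idealComponent.1
    (hspan ▸ Submodule.subset_span (by simp) : l₂ ∈ idealComponent (bourbakiIdeal f ρ₁ ρ₂) 1)
  obtain ⟨ρ₃, m₃, hom₃, v₃⟩ := H.exists_homogeneous_lift hl₁B hl₁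
  obtain ⟨ρ₄, m₄, hom₄, v₄⟩ := H.exists_homogeneous_lift hl₂B hl₂
  have hl₁0 : l₁ ≠ 0 := hli.ne_zero 0
  -- The Koszul combination has value zero, so it lies in the span of `ρ₁, ρ₂`. Taking components of
  -- degree `e₃ + 2` makes the coefficients homogeneous; the subtractions are not truncated since
  -- `e₁, e₂ ≤ e₃`.
  obtain ⟨a, b, ha, hb, hab⟩ : ∃ a b : S, a.IsHomogeneous (e₃ + 1 + 1 - e₁) ∧
      b.IsHomogeneous (e₃ + 1 + 1 - e₂) ∧ a • ρ₁ + b • ρ₂ = l₁ • ρ₄ - l₂ • ρ₃ := by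
    obtain ⟨a, b, hab⟩ := H.exact (l₁ • ρ₄ - l₂ • ρ₃)
      (sub_mem (Submodule.smul_mem _ _ m₄) (Submodule.smul_mem _ _ m₃)) (by
        rw [cross_sub, cross_smul, cross_smul, v₃, v₄, smul_smul, smul_smul, mul_comm, sub_self])
    refine ⟨_, _, homogeneousComponent_isHomogeneous _ a, homogeneousComponent_isHomogeneous _ b,
      ?_⟩
    have h := congrArg (vecComponent (e₃ + 1 + 1)) hab
    have hr : HomogeneousVec (l₁ • ρ₄ - l₂ • ρ₃) (e₃ + 1 + 1) := by
      have := (hom₄.smul hl₁).sub (hom₃.smul hl₂)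
      rwa [show 1 + (1 + e₃) = e₃ + 1 + 1 by omega] at this
    rwa [vecComponent_add, H.hom₁.vecComponent_smul (by omega),
      H.hom₂.vecComponent_smul (by omega), hr.vecComponent_eq] at h
  have hcc {p : S} {n : ℕ} (hp : p.IsHomogeneous n) (hn : n ≠ 0) : constantCoeff p = 0 := by
    rw [constantCoeff_eq]
    exact hp.coeff_eq_zero (by simpa using hn.symm)
  have hr : ∀ j, HomogeneousVec (![ρ₁, ρ₂, ρ₃, ρ₄] j) (![e₁, e₂, e₃ + 1, e₃ + 1] j) := by
    rw [add_comm] at hom₃ hom₄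
    intro j
    fin_cases j
    exacts [H.hom₁, H.hom₂, hom₃, hom₄]
  have hrel : ∀ j, (![-a, -b, -l₂, l₁] j).IsHomogeneous
      (e₃ + 1 + 1 - ![e₁, e₂, e₃ + 1, e₃ + 1] j) := by
    intro j
    fin_cases j
    · exact ha.neg
    · exact hb.neg
    · simpa using hl₂.neg
    · simpa using hl₁
  refine ⟨h₁, h₁₂, by omega, ![ρ₁, ρ₂, ρ₃, ρ₄], ![-a, -b, -l₂, l₁], hr, hrel, ?_, ?_, ?_,
    fun j => hcc (hrel j) ?_, fun j i => hcc (hr j i) ?_,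
    fun i => hcc (H.hom_grad i) (by omega)⟩
  · intro s t hst
    have := congrFun hst 3
    simp only [LinearMap.toSpanSingleton_apply, Pi.smul_apply, Matrix.cons_val,
      smul_eq_mul] at this
    exact mul_right_cancel₀ hl₁0 this
  · intro c
    simp only [Fintype.linearCombination_apply, Fin.sum_univ_four, Matrix.cons_val,
      Set.mem_range, LinearMap.toSpanSingleton_apply]
    constructor
    · intro hc
      -- Taking values leaves `c 2 * l₁ + c 3 * l₂ = 0`, so `(c 2, c 3)` is a multiple `t` of `(-l₂,
      -- l₁)`; freeness of `ρ₁, ρ₂` then determines `c 0` and `c 1`.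
      have hv := congrArg (cross ρ₁ ρ₂) hc
      rw [cross_add, cross_add, cross_add, cross_smul, cross_smul, cross_smul, cross_smul, v₃, v₄,
        cross_left_self, cross_right_self, smul_zero, smul_zero, zero_add, zero_add, smul_smul,
        smul_smul, ← add_smul, ← zero_smul S ρ₁, cross_smul, zero_smul,
        ← zero_smul S (grad f)] at hv
      have hc23 := H.value_unique hv
      obtain ⟨t, ht⟩ := dvd_of_dvd_mul_of_linearIndependent hl₁ hl₂ hli (p := c 3)
        ⟨-c 2, by linear_combination hc23⟩
      have hc2 : c 2 = -(l₂ * t) := by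
        refine mul_right_cancel₀ hl₁0 ?_
        rw [ht] at hc23
        linear_combination hc23
      obtain ⟨h0, h1⟩ := H.injective (c 0 + t * a) (c 1 + t * b) (by
        have : (c 0 + t * a) • ρ₁ + (c 1 + t * b) • ρ₂ =
          c 0 • ρ₁ + c 1 • ρ₂ + t • (a • ρ₁ + b • ρ₂) := by module
        rw [this, hab, ← hc, ht, hc2]
        module)
      refine ⟨t, funext fun i => ?_⟩
      fin_cases i <;> simp only [Pi.smul_apply, smul_eq_mul, Fin.zero_eta, Fin.mk_one,
        Fin.reduceFinMk, Matrix.cons_val]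
      · linear_combination -h0
      · linear_combination -h1
      · linear_combination -hc2
      · linear_combination -ht
    · rintro ⟨t, rfl⟩
      simp only [Pi.smul_apply, Matrix.cons_val, smul_eq_mul]
      have : (t * -a) • ρ₁ + (t * -b) • ρ₂ + (t * -l₂) • ρ₃ + (t * l₁) • ρ₄ =
        t • ((l₁ • ρ₄ - l₂ • ρ₃) - (a • ρ₁ + b • ρ₂)) := by module
      rw [this, hab, sub_self, smul_zero]
  · intro ρ
    simp only [Fintype.linearCombination_apply, Fin.sum_univ_four, Matrix.cons_val,
      Set.mem_range]
    constructor
    · intro hρ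
      obtain ⟨h, v⟩ := H.exists_value ρ hρ
      have hmem : h ∈ Ideal.span {l₁, l₂} := by
        by_contra hh
        exact hone (H.one_mem_of_notMem hl₁ hl₂ hli m₃ m₄ hρ v₃ v₄ v hh)
      obtain ⟨p, q, rfl⟩ := Ideal.mem_span_pair.1 hmem
      obtain ⟨s, t, hst⟩ := H.exact (ρ - (p • ρ₃ + q • ρ₄))
        (sub_mem hρ (add_mem (Submodule.smul_mem _ _ m₃) (Submodule.smul_mem _ _ m₄))) (by
          rw [cross_sub, cross_add, cross_smul, cross_smul, v₃, v₄, v]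
          module)
      refine ⟨![s, t, p, q], ?_⟩
      simp only [Matrix.cons_val]
      rw [hst]
      module
    · rintro ⟨c, rfl⟩
      exact add_mem (add_mem (add_mem (Submodule.smul_mem _ _ H.mem₁)
        (Submodule.smul_mem _ _ H.mem₂)) (Submodule.smul_mem _ _ m₃)) (Submodule.smul_mem _ _ m₄)
  · fin_cases j <;> simp <;> omega
  · fin_cases j <;> simp <;> omega

theorem finrank_eq_two_of_isNearlyFree (h₁₂ : e₁ ≤ e₂) (h₂₃ : e₂ ≤ e₃)
    (hnf : IsNearlyFree f e₁ e₂ (e₃ + 1)) :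
    Module.finrank ℂ (idealComponent (bourbakiIdeal f ρ₁ ρ₂) 1) = 2 := by
  obtain ⟨-, -, -, r, a, hr, -, -, hrel, hgen, ha, -, -⟩ := hnf
  have hmem (j : Fin 4) : r j ∈ AR f := by
    refine (hgen (r j)).2 ⟨Pi.single j 1, ?_⟩
    simp [Fintype.linearCombination_apply, Pi.single_apply]
  have hspan (ρ : Fin 4 → S) (hρ : ρ ∈ AR f) :
      ∃ c : Fin 4 → S, c 0 • r 0 + c 1 • r 1 + c 2 • r 2 + c 3 • r 3 = ρ := by
    obtain ⟨c, hc⟩ := (hgen ρ).1 hρ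
    exact ⟨c, by rw [← hc, Fintype.linearCombination_apply, Fin.sum_univ_four]⟩
  have hr2 : HomogeneousVec (r 2) (e₃ + 1) := hr 2
  have hr3 : HomogeneousVec (r 3) (e₃ + 1) := hr 3
  -- In degrees at most `e₃` the generators `r 2, r 3` cannot contribute.
  have hlow {ρ : Fin 4 → S} (hρ : ρ ∈ AR f) {e : ℕ} (he : e < e₃ + 1)
      (hom : HomogeneousVec ρ e) : ∃ p q : S, p • r 0 + q • r 1 = ρ := by
    obtain ⟨c, hc⟩ := hspan ρ hρ
    have low {k : ℕ} {u : Fin 4 → S} (hu : HomogeneousVec u k) (c : S) :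
        ∃ c' : S, vecComponent e (c • u) = c' • u := by
      rcases le_or_gt k e with h | h
      · exact ⟨_, hu.vecComponent_smul h c⟩
      · exact ⟨0, by rw [hu.vecComponent_smul_of_lt h, zero_smul]⟩
    obtain ⟨p, hp⟩ := low (hr 0) (c 0)
    obtain ⟨q, hq⟩ := low (hr 1) (c 1)
    refine ⟨p, q, ?_⟩
    have := congrArg (vecComponent e) hc
    rwa [vecComponent_add, vecComponent_add, vecComponent_add, hp, hq,
      hr2.vecComponent_smul_of_lt he, hr3.vecComponent_smul_of_lt he, add_zero, add_zero,
      hom.vecComponent_eq] at this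
  obtain ⟨p, q, h1⟩ := hlow H.mem₁ (by omega) H.hom₁
  obtain ⟨s, t, h2⟩ := hlow H.mem₂ (by omega) H.hom₂
  -- If the determinant vanished, Cramer's rule would give relations between `ρ₁` and `ρ₂`, forcing
  -- `p = q = 0` and `ρ₁ = 0`.
  have hdet : p * t - q * s ≠ 0 := by
    intro h0
    obtain ⟨ht, hq⟩ := H.injective t (-q) (by
      rw [← h1, ← h2, ← zero_smul S (r 0), ← h0]; module)
    obtain ⟨hs, hp⟩ := H.injective (-s) p (by
      rw [← h1, ← h2, ← zero_smul S (r 1), ← h0]; module)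
    rw [neg_eq_zero] at hq
    have := H.injective 1 0 (by rw [← h1, hp, hq]; module)
    exact one_ne_zero this.1
  have hker {u : Fin 4 → S} {x y : S} (hu : x • ρ₁ + y • ρ₂ = (p * t - q * s) • u) :
      cross ρ₁ ρ₂ u = 0 := by
    have := cross_smul ρ₁ ρ₂ u (p * t - q * s)
    rw [← hu, cross_add, cross_smul, cross_smul, cross_left_self, cross_right_self, smul_zero,
      smul_zero, add_zero] at this
    exact (smul_eq_zero.1 this.symm).resolve_left hdet
  have v0 : cross ρ₁ ρ₂ (r 0) = 0 := hker (x := t) (y := -q) (by rw [← h1, ← h2]; module)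
  have v1 : cross ρ₁ ρ₂ (r 1) = 0 := hker (x := -s) (y := p) (by rw [← h1, ← h2]; module)
  obtain ⟨l₁, v2⟩ := H.exists_value _ (hmem 2)
  obtain ⟨l₂, v3⟩ := H.exists_value _ (hmem 3)
  rw [add_comm] at hr2 hr3
  have hl₁ := H.isHomogeneous_value hr2 v2
  have hl₂ := H.isHomogeneous_value hr3 v3
  refine finrank_eq_two_iff.2 ⟨l₁, l₂, LinearIndependent.pair_iff.2 fun x y hxy => ?_,
    le_antisymm ?_ ?_⟩
  -- A constant relation between the values yields a relation between the `r j` with constant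
  -- entries `x, y`. It is a multiple of `a`, whose entries have no constant term, so `x = y = 0`.
  · obtain ⟨b, c, hbc⟩ := H.exact (C x • r 2 + C y • r 3)
      (add_mem (Submodule.smul_mem _ _ (hmem 2)) (Submodule.smul_mem _ _ (hmem 3))) (by
        rw [cross_add, cross_smul, cross_smul, v2, v3, smul_smul, smul_smul, ← add_smul,
          ← smul_eq_C_mul, ← smul_eq_C_mul, hxy, zero_smul])
    obtain ⟨z, hz⟩ := (hrel ![-(b * p + c * s), -(b * q + c * t), C x, C y]).1 (by
      rw [Fintype.linearCombination_apply, Fin.sum_univ_four]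
      simp only [Matrix.cons_val]
      rw [add_assoc, ← hbc, ← h1, ← h2]
      module)
    have hx := congrArg constantCoeff (congrFun hz 2)
    have hy := congrArg constantCoeff (congrFun hz 3)
    simp only [LinearMap.toSpanSingleton_apply, Pi.smul_apply, smul_eq_mul, map_mul, ha, mul_zero,
      Matrix.cons_val, constantCoeff_C] at hx hy
    exact ⟨hx.symm, hy.symm⟩
  · intro h hh
    obtain ⟨hB, hhom⟩ := mem_idealComponent.1 hh
    obtain ⟨ρ, hρ, v⟩ := mem_bourbakiIdeal.1 hB
    obtain ⟨c, rfl⟩ := hspan ρ hρ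
    rw [cross_add, cross_add, cross_add, cross_smul, cross_smul, cross_smul, cross_smul, v0, v1,
      v2, v3, smul_zero, smul_zero, zero_add, zero_add, smul_smul, smul_smul, ← add_smul] at v
    -- In degree one only the constant terms of `c 2` and `c 3` survive.
    have hc := congrArg (homogeneousComponent 1) (H.value_unique v)
    rw [map_add, homogeneousComponent_mul_of_le hl₁ le_rfl,
      homogeneousComponent_mul_of_le hl₂ le_rfl, homogeneousComponent_eq_self hhom, Nat.sub_self,
      homogeneousComponent_zero, homogeneousComponent_zero, ← smul_eq_C_mul,
      ← smul_eq_C_mul] at hc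
    exact Submodule.mem_span_pair.2 ⟨_, _, hc⟩
  · refine Submodule.span_le.2 ?_
    rintro l (rfl | rfl)
    · exact mem_idealComponent.2 ⟨mem_bourbakiIdeal.2 ⟨_, hmem 2, v2⟩, hl₁⟩
    · exact mem_idealComponent.2 ⟨mem_bourbakiIdeal.2 ⟨_, hmem 3, v3⟩, hl₂⟩

end BourbakiSequence

/-- A nonzero syzygy of degree zero would be a linear relation over `ℂ` between the partials. -/
theorem IsMinimalPair.one_le {f : S} {ρ₁ ρ₂ : Fin 4 → S} {e₁ e₂ : ℕ}
    (hmin : IsMinimalPair f ρ₁ ρ₂ e₁ e₂)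
    (hcone : LinearIndependent ℂ (fun i : Fin 4 => pderiv i f)) : 1 ≤ e₁ := by
  by_contra! h0
  obtain rfl : e₁ = 0 := by omega
  have hC (i : Fin 4) : ρ₁ i = C (coeff 0 (ρ₁ i)) := by
    rw [← homogeneousComponent_zero, homogeneousComponent_eq_self (hmin.hom₁ i)]
  have h := mem_AR.1 hmin.mem₁
  have hz := Fintype.linearIndependent_iff.1 hcone (fun i => coeff 0 (ρ₁ i)) (by
    rw [← h]
    refine Finset.sum_congr rfl fun i _ => ?_
    rw [smul_eq_C_mul, ← hC]
    rfl)
  exact hmin.ne_zero₁ (funext fun i => by rw [hC, hz, C_0, Pi.zero_apply])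

theorem IsMinimalPair.le {f : S} {ρ₁ ρ₂ : Fin 4 → S} {e₁ e₂ : ℕ}
    (hmin : IsMinimalPair f ρ₁ ρ₂ e₁ e₂) : e₁ ≤ e₂ :=
  hmin.min₁ ρ₂ hmin.mem₂ e₂ hmin.hom₂ fun h => hmin.notMem₂ (h ▸ Submodule.zero_mem _)

end Syzygies

end TameSurface

end

theorem proposition5p1 (f : TameSurface.S) (d : ℕ) (hf : f.IsHomogeneous d)
    (hred : Squarefree f)
    (hcone : LinearIndependent ℂ (fun i : Fin 4 => MvPolynomial.pderiv i f))
    (ρ₁ ρ₂ : Fin 4 → TameSurface.S) (e₁ e₂ e₃ : ℕ)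
    (hmin : TameSurface.IsMinimalPair f ρ₁ ρ₂ e₁ e₂)
    (htame : TameSurface.IsTame f ρ₁ ρ₂)
    (he₃ : (e₃ : ℤ) = (d : ℤ) - 1 - e₁ - e₂)
    (he₂₃ : e₂ ≤ e₃) :
    TameSurface.IsNearlyFree f e₁ e₂ (e₃ + 1) ↔
      Module.finrank ℂ
        (TameSurface.idealComponent (TameSurface.bourbakiIdeal f ρ₁ ρ₂) 1) = 2 := by
  have H := TameSurface.bourbakiSequence hf hred hcone hmin htame
    (e₃ := e₃) (by omega)
  exact ⟨H.finrank_eq_two_of_isNearlyFree hmin.le he₂₃,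
    H.isNearlyFree_of_finrank_eq_two (hmin.one_le hcone) hmin.le he₂₃⟩
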